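/- Let $N\ge 1$ and let the source $X\in\mathbb{R}^N$ be a zero-mean Gaussian random vector with positive-definite covariance matrix $\boldsymbol{K}_X$, with eigenvalues $\lambda_1,\dots,\lambda_N$ (with multiplicity). For random vectors $U,V$ in $\mathbb{R}^N$ write $\boldsymbol{K}_{U}=\mathbb{E}[UU^T]$, let $I(U;V)$ be their mutual information (natural logarithm, value $+\infty$ allowed) and let $\bar I(U;V)=\frac1N I(U;V)$. For $D>0$, call a random vector $Y$ in $\mathbb{R}^N$, defined jointly with $X$, admissible if $Y-X$ has finite second moments, $$\mathbb{E}[X(Y-X)^T]=\boldsymbol 0,\qquad \tfrac1N\operatorname{tr}(\boldsymbol{K}_{Y-X})\le D,\qquad \det \boldsymbol{K}_{Y-X}>0 .$$ The uncorrelated quadratic rate-distortion function is $R^\perp(D)=\min_Y \bar I(X;Y)$ over all admissible $Y$, where all joint distributions of $(X,Y)$ with the given distribution of $X$ are allowed. Then, for every $D>0$: (i) The minimum is attained, and $$R^\perp(D)=\frac1N\sum_{k=1}^N\log\left(\frac{\sqrt{\lambda_k+\alpha}+\sqrt{\lambda_k}}{\sqrt{\alpha}}\right),$$ where $\alpha>0$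 is such that $$D=\frac{1}{2N}\sum_{k=1}^N\left(\sqrt{\lambda_k^2+\lambda_k\alpha}-\lambda_k\right).\qquad(*)$$ (ii) There is exactly one $\alpha>0$ that satisfies $(*)$. (iii) Let $Y$ be admissible and put $Z=Y-X$. Then $\bar I(X;Y)=R^\perp(D)$ if and only if $X$ and $Z$ are jointly Gaussian and $Z\sim\mathcal N(\boldsymbol 0,\boldsymbol{K}_{Z^\star})$ with $$\boldsymbol{K}_{Z^\star}=\tfrac12\sqrt{\boldsymbol{K}_X^2+\alpha\boldsymbol{K}_X}-\tfrac12\boldsymbol{K}_X,$$ where $\alpha>0$ satisfies $(*)$ and $\sqrt{\cdot}$ is the positive-definite matrix square root. -/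

import Mathlib

open MeasureTheory ProbabilityTheory InformationTheory
open scoped ENNReal

noncomputable section

namespace UncorrelatedRD

/-- The matrix `E[U Vᵀ]` of the second-order (uncentered) cross moments of two random vectors. -/
def crossMoment {Ω : Type*} [MeasurableSpace Ω] {N : ℕ} (P : Measure Ω)
    (U V : Ω → EuclideanSpace ℝ (Fin N)) : Matrix (Fin N) (Fin N) ℝ :=
  Matrix.of fun i j => ∫ ω, U ω i * V ω j ∂P

/-- The mutual information `I(U; V)` (in nats): the relative entropy of the joint law with respect
to the product of the marginal laws. -/
def mutualInfo {Ω E F : Type*} [MeasurableSpace Ω] [MeasurableSpace E] [MeasurableSpace F]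
    (P : Measure Ω) (U : Ω → E) (V : Ω → F) : ℝ≥0∞ :=
  klDiv (P.map fun ω => (U ω, V ω)) ((P.map U).prod (P.map V))

/-- The mutual information per dimension, `(1/N) I(U; V)`. -/
def mutualInfoPerDim {Ω : Type*} [MeasurableSpace Ω] {N : ℕ} (P : Measure Ω)
    (U V : Ω → EuclideanSpace ℝ (Fin N)) : ℝ≥0∞ :=
  mutualInfo P U V / (N : ℝ≥0∞)

/-- `Y` is an admissible reconstruction of `X` at distortion `D`: the error `Z = Y - X` has finite
second moments, `E[X Zᵀ] = 0`, `tr (E[Z Zᵀ]) / N ≤ D` and `det (E[Z Zᵀ]) > 0`. -/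
structure Admissible {Ω : Type*} [MeasurableSpace Ω] {N : ℕ} (P : Measure Ω)
    (X Y : Ω → EuclideanSpace ℝ (Fin N)) (D : ℝ) : Prop where
  aemeasurable : AEMeasurable Y P
  memLp_error : MemLp (fun ω => Y ω - X ω) 2 P
  integrable_cross : ∀ i j, Integrable (fun ω => X ω i * (Y ω - X ω) j) P
  uncorrelated : crossMoment P X (fun ω => Y ω - X ω) = 0
  distortion_le : (1 / (N : ℝ)) *
    (crossMoment P (fun ω => Y ω - X ω) (fun ω => Y ω - X ω)).trace ≤ D
  det_pos : 0 < (crossMoment P (fun ω => Y ω - X ω) (fun ω => Y ω - X ω)).det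

/-- The rates `(1/N) I(X; Y)` of all admissible reconstructions `Y` of a source `X` with law `μ`.
As the rate and the constraints depend only on the joint law `π` of `(X, Y)`, the pair is realized
as the two coordinates on `(ℝ^N × ℝ^N, π)`; thus `Y` may use randomness beyond that of `X`. -/
def admissibleRates {N : ℕ} (μ : Measure (EuclideanSpace ℝ (Fin N))) (D : ℝ) : Set ℝ≥0∞ :=
  {r | ∃ π : Measure (EuclideanSpace ℝ (Fin N) × EuclideanSpace ℝ (Fin N)),
    IsProbabilityMeasure π ∧ π.map Prod.fst = μ ∧ Admissible π Prod.fst Prod.snd D ∧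
      r = mutualInfoPerDim π Prod.fst Prod.snd}

/-- The uncorrelated quadratic rate-distortion function `R^⊥(D)` of a source with law `μ`. -/
def rdPerp {N : ℕ} (μ : Measure (EuclideanSpace ℝ (Fin N))) (D : ℝ) : ℝ≥0∞ :=
  sInf (admissibleRates μ D)

section
open scoped MatrixOrder

/-- The matrix `½ √(K² + α K) - ½ K`, with the positive semidefinite matrix square root. -/
def optimalErrorCov {N : ℕ} (K : Matrix (Fin N) (Fin N) ℝ) (α : ℝ) :
    Matrix (Fin N) (Fin N) ℝ :=
  (1 / 2 : ℝ) • CFC.sqrt (K ^ 2 + α • K) - (1 / 2 : ℝ) • K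

end

end UncorrelatedRD

end

/-! Work in an eigenbasis of the source covariance, with eigenvalues `l k`, and let `z k` be the
candidate error variances. The test function `f` is the log-density, relative to the source law, of
the backward channel from `Y` to `X` belonging to `Y = X + Z` with independent Gaussian `Z` of
variances `z`. It integrates to one in `x` for every fixed `y`, so `κ.tilted f`, with `κ` the
product of the marginals of an arbitrary pair, is a probability measure, and `I(X;Y) = KL(π ‖
κ.tilted f) + E f ≥ E f`.

Since `f` is quadratic, `E f` depends only on second moments. With `E[X Zᵀ] = 0` it is the sum over
`k` of `½ log ((l k + z k) / z k)` plus `l k / (2 z k (l k + z k))` times the excess of `z k` over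
the actual error variance. The choice `z k (l k + z k) = α l k / 4` makes that weight `2 / α` for
every `k`, so only the trace of the error covariance matters, and the distortion constraint makes
the total correction nonnegative.

Equality forces `π = κ.tilted f`. Requiring the backward channel to output the source law then
determines the law of `Y`, by cancelling a nonvanishing Gaussian characteristic function, and hence
that of `(X, Z)`. The lemmas carrying this are `toReal_klDiv_tilted_add_integral`,
`integral_infoDensityBasis`, `eq_diagGaussian_of_map_fst_tilted` and `mutualInfo_bound`. -/

namespace UncorrelatedRD

/-! ### The scalar backward channel. -/

/-- The pointwise logarithm of the density of `N(λ y / (λ + z), λ z / (λ + z))` with respect to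
`N(0, λ)`, that is, of the backward channel of `y = x + w`, `x ∼ N(0, λ)`, `w ∼ N(0, z)`. -/
noncomputable def infoDensity (l z x y : ℝ) : ℝ :=
  1 / 2 * Real.log ((l + z) / z) + x ^ 2 / (2 * l)
    - (x - l / (l + z) * y) ^ 2 / (2 * (l * z / (l + z)))

theorem continuous_infoDensity (l z : ℝ) :
    Continuous fun p : ℝ × ℝ => infoDensity l z p.1 p.2 := by
  unfold infoDensity
  fun_prop

theorem gaussianPDFReal_mul_exp_infoDensity {l z : ℝ} (hl : 0 < l) (hz : 0 < z) (x y : ℝ) :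
    gaussianPDFReal 0 l.toNNReal x * Real.exp (infoDensity l z x y)
      = gaussianPDFReal (l / (l + z) * y) (l * z / (l + z)).toNNReal x := by
  have hlz : 0 < l + z := by positivity
  have hc : 0 < l * z / (l + z) := by positivity
  simp only [gaussianPDFReal, Real.coe_toNNReal _ hl.le, Real.coe_toNNReal _ hc.le]
  have h1 : Real.exp (1 / 2 * Real.log ((l + z) / z)) = √((l + z) / z) := by
    rw [Real.sqrt_eq_rpow, Real.rpow_def_of_pos (by positivity), mul_comm]
  have h2 : (√(2 * Real.pi * (l * z / (l + z))))⁻¹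
      = (√(2 * Real.pi * l))⁻¹ * √((l + z) / z) := by
    rw [← Real.sqrt_inv, ← Real.sqrt_inv, ← Real.sqrt_mul (by positivity)]
    congr 1
    field_simp
  rw [h2, ← h1, mul_assoc, mul_assoc (√(2 * Real.pi * l))⁻¹, ← Real.exp_add, ← Real.exp_add]
  congr 2
  unfold infoDensity
  ring

/-- By the density identity, the left side is the characteristic function of the channel output law
for input `y`. -/
theorem integral_exp_infoDensity_smul {l z : ℝ} (hl : 0 < l) (hz : 0 < z) (y s : ℝ) :
    ∫ x, Complex.exp (↑(x * s) * Complex.I) * (Real.exp (infoDensity l z x y) : ℂ)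
        ∂gaussianReal 0 l.toNNReal
      = Complex.exp (↑(l / (l + z) * y * s) * Complex.I
          - ((l * z / (l + z) * s ^ 2 / 2 : ℝ) : ℂ)) := by
  have hlz : 0 < l + z := by positivity
  have hc : 0 < l * z / (l + z) := by positivity
  have h := charFun_gaussianReal (μ := l / (l + z) * y) (v := (l * z / (l + z)).toNNReal) s
  rw [charFun_apply, integral_gaussianReal_eq_integral_smul (by simpa using hc)] at h
  rw [integral_gaussianReal_eq_integral_smul (by simpa using hl)]
  trans Complex.exp (↑s * ↑(l / (l + z) * y) * Complex.I
    - ↑(↑(l * z / (l + z)).toNNReal : ℝ) * ↑s ^ 2 / 2)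
  · rw [← h]
    refine integral_congr_ae (.of_forall fun x => ?_)
    simp only [← gaussianPDFReal_mul_exp_infoDensity hl hz, Complex.real_smul]
    have : inner ℝ x s = x * s := by simp [mul_comm]
    rw [this]
    push_cast
    ring
  · rw [Real.coe_toNNReal _ hc.le]
    push_cast
    ring_nf

/-! ### The backward channel in an orthonormal basis. -/

section Basis

variable {ι E : Type*} [Fintype ι] [NormedAddCommGroup E] [InnerProductSpace ℝ E]

theorem continuous_sum_smul_basis (b : OrthonormalBasis ι ℝ E) :
    Continuous fun x : ι → ℝ => ∑ k, x k • b k := by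
  fun_prop

theorem inner_basis_sum_smul (b : OrthonormalBasis ι ℝ E) (x : ι → ℝ) (k : ι) :
    inner ℝ (b k) (∑ j, x j • b j) = x k := by
  classical
  simp [inner_sum, inner_smul_right, b.inner_eq_ite]

/-- The log-density of the backward channel in the coordinates of an orthonormal basis. -/
noncomputable def infoDensityBasis (b : OrthonormalBasis ι ℝ E) (l z : ι → ℝ) (p : E × E) : ℝ :=
  ∑ k, infoDensity (l k) (z k) (inner ℝ (b k) p.1) (inner ℝ (b k) p.2)

theorem continuous_infoDensityBasis (b : OrthonormalBasis ι ℝ E) (l z : ι → ℝ) :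
    Continuous (infoDensityBasis b l z) := by
  unfold infoDensityBasis
  refine continuous_finsetSum _ fun k _ => ?_
  exact (continuous_infoDensity (l k) (z k)).comp
    (f := fun p : E × E => (inner ℝ (b k) p.1, inner ℝ (b k) p.2)) (by fun_prop)

variable [MeasurableSpace E] [BorelSpace E]

/-- The centered Gaussian measure whose coordinates in the orthonormal basis `b` are independent
with variances `v`. -/
noncomputable def diagGaussian (b : OrthonormalBasis ι ℝ E) (v : ι → ℝ) : Measure E :=
  (Measure.pi fun k => gaussianReal 0 (v k).toNNReal).map fun x => ∑ k, x k • b k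

instance isProbabilityMeasure_diagGaussian (b : OrthonormalBasis ι ℝ E) (v : ι → ℝ) :
    IsProbabilityMeasure (diagGaussian b v) :=
  Measure.isProbabilityMeasure_map (continuous_sum_smul_basis b).measurable.aemeasurable

variable [SecondCountableTopology E]

theorem charFun_diagGaussian (b : OrthonormalBasis ι ℝ E) {v : ι → ℝ} (hv : ∀ k, 0 ≤ v k) (t : E) :
    charFun (diagGaussian b v) t
      = Complex.exp (-((∑ k, v k * inner ℝ (b k) t ^ 2 / 2 : ℝ) : ℂ)) := by
  rw [charFun_apply, diagGaussian, integral_map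
    (continuous_sum_smul_basis b).measurable.aemeasurable (by fun_prop)]
  have h (x : ι → ℝ) : Complex.exp (↑(inner ℝ (∑ k, x k • b k) t) * Complex.I)
      = ∏ k, Complex.exp (↑(x k * inner ℝ (b k) t) * Complex.I) := by
    rw [← Complex.exp_sum, sum_inner]
    simp only [real_inner_smul_left]
    push_cast
    rw [Finset.sum_mul]
  simp_rw [h]
  rw [integral_fintype_prod_eq_prod
    (f := fun k x => Complex.exp (↑(x * inner ℝ (b k) t) * Complex.I))]
  rw [Complex.ofReal_sum, ← Finset.sum_neg_distrib, Complex.exp_sum]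
  refine Finset.prod_congr rfl fun k _ => ?_
  have h := charFun_gaussianReal (μ := 0) (v := (v k).toNNReal) (inner ℝ (b k) t)
  rw [charFun_apply, Real.coe_toNNReal _ (hv k)] at h
  have hr (x u : ℝ) : inner ℝ x u = x * u := by simp [mul_comm]
  simp only [hr] at h
  rw [h]
  push_cast
  ring_nf

theorem integral_exp_infoDensityBasis_mul (b : OrthonormalBasis ι ℝ E) {l z : ι → ℝ}
    (hl : ∀ k, 0 < l k) (hz : ∀ k, 0 < z k) (y s : E) :
    ∫ x, Complex.exp (↑(inner ℝ x s) * Complex.I) * (Real.exp (infoDensityBasis b l z (x, y)) : ℂ)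
        ∂diagGaussian b l
      = Complex.exp (↑(inner ℝ y (∑ k, (l k / (l k + z k) * inner ℝ (b k) s) • b k)) * Complex.I
          - ((∑ k, l k * z k / (l k + z k) * inner ℝ (b k) s ^ 2 / 2 : ℝ) : ℂ)) := by
  have hcont := continuous_infoDensityBasis b l z
  rw [diagGaussian, integral_map
    (continuous_sum_smul_basis b).measurable.aemeasurable (by fun_prop)]
  have h (x : ι → ℝ) : Complex.exp (↑(inner ℝ (∑ k, x k • b k) s) * Complex.I)
        * (Real.exp (infoDensityBasis b l z (∑ k, x k • b k, y)) : ℂ)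
      = ∏ k, (Complex.exp (↑(x k * inner ℝ (b k) s) * Complex.I)
        * (Real.exp (infoDensity (l k) (z k) (x k) (inner ℝ (b k) y)) : ℂ)) := by
    rw [Finset.prod_mul_distrib, ← Complex.exp_sum, sum_inner, ← Complex.ofReal_prod,
      ← Real.exp_sum]
    simp only [real_inner_smul_left, infoDensityBasis, inner_basis_sum_smul]
    push_cast
    rw [Finset.sum_mul]
  simp_rw [h]
  rw [integral_fintype_prod_eq_prod
    (f := fun k x => Complex.exp (↑(x * inner ℝ (b k) s) * Complex.I)
        * (Real.exp (infoDensity (l k) (z k) x (inner ℝ (b k) y)) : ℂ))]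
  simp_rw [integral_exp_infoDensity_smul (hl _) (hz _)]
  rw [← Complex.exp_sum, inner_sum]
  simp only [inner_smul_right]
  push_cast
  rw [Finset.sum_sub_distrib, ← Finset.sum_mul]
  congr 3
  refine Finset.sum_congr rfl fun k _ => ?_
  rw [real_inner_comm (b k) y]
  ring

/-- The characteristic function at frequency zero. Because the normalization holds for each `y`, any
law of `Y` may serve as input. -/
theorem integral_exp_infoDensityBasis_left (b : OrthonormalBasis ι ℝ E) {l z : ι → ℝ}
    (hl : ∀ k, 0 < l k) (hz : ∀ k, 0 < z k) (y : E) :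
    ∫ x, Real.exp (infoDensityBasis b l z (x, y)) ∂diagGaussian b l = 1 := by
  have h := integral_exp_infoDensityBasis_mul b hl hz y 0
  simp only [inner_zero_right, Complex.ofReal_zero, zero_mul, Complex.exp_zero, one_mul, mul_zero,
    zero_smul, Finset.sum_const_zero, ne_eq, OfNat.ofNat_ne_zero, not_false_eq_true, zero_pow,
    zero_div, sub_zero] at h
  rw [integral_complex_ofReal] at h
  exact_mod_cast h

theorem integrable_exp_infoDensityBasis (b : OrthonormalBasis ι ℝ E) {l z : ι → ℝ}
    (hl : ∀ k, 0 < l k) (hz : ∀ k, 0 < z k) (ν : Measure E) [IsProbabilityMeasure ν] :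
    Integrable (fun p => Real.exp (infoDensityBasis b l z p)) ((diagGaussian b l).prod ν) := by
  have hcont := continuous_infoDensityBasis b l z
  rw [integrable_prod_iff' (by fun_prop)]
  refine ⟨.of_forall fun y => ?_, ?_⟩
  -- A Bochner integral that is nonzero can only come from an integrable function.
  · refine .of_integral_ne_zero ?_
    rw [integral_exp_infoDensityBasis_left b hl hz]
    exact one_ne_zero
  · simp only [Real.norm_eq_abs, Real.abs_exp, integral_exp_infoDensityBasis_left b hl hz]
    exact integrable_const _

theorem integral_exp_infoDensityBasis (b : OrthonormalBasis ι ℝ E) {l z : ι → ℝ}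
    (hl : ∀ k, 0 < l k) (hz : ∀ k, 0 < z k) (ν : Measure E) [IsProbabilityMeasure ν] :
    ∫ p, Real.exp (infoDensityBasis b l z p) ∂(diagGaussian b l).prod ν = 1 := by
  rw [integral_prod_symm _ (integrable_exp_infoDensityBasis b hl hz ν)]
  simp [integral_exp_infoDensityBasis_left b hl hz]

/-- The characteristic function of the law of `(x, y)` when `y ∼ ν` and `x` is the output of the
backward channel for the input `y`. -/
theorem integral_tilted_infoDensityBasis (b : OrthonormalBasis ι ℝ E) {l z : ι → ℝ}
    (hl : ∀ k, 0 < l k) (hz : ∀ k, 0 < z k) (ν : Measure E) [IsProbabilityMeasure ν] (s t : E) :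
    ∫ p, Complex.exp (↑(inner ℝ p.1 s + inner ℝ p.2 t) * Complex.I)
        ∂((diagGaussian b l).prod ν).tilted (infoDensityBasis b l z)
      = charFun ν (t + ∑ k, (l k / (l k + z k) * inner ℝ (b k) s) • b k)
        * Complex.exp (-((∑ k, l k * z k / (l k + z k) * inner ℝ (b k) s ^ 2 / 2 : ℝ) : ℂ)) := by
  have hcont := continuous_infoDensityBasis b l z
  rw [integral_tilted, integral_exp_infoDensityBasis b hl hz ν]
  simp only [div_one]
  rw [integral_prod_symm]
  · rw [charFun_apply, ← integral_mul_const]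
    refine integral_congr_ae (.of_forall fun y => ?_)
    simp only
    trans ∫ x, Complex.exp (↑(inner ℝ y t) * Complex.I) *
      (Complex.exp (↑(inner ℝ x s) * Complex.I) * (Real.exp (infoDensityBasis b l z (x, y)) : ℂ))
        ∂diagGaussian b l
    · refine integral_congr_ae (.of_forall fun x => ?_)
      simp only [Complex.real_smul]
      rw [Complex.ofReal_add, add_mul, Complex.exp_add]
      ring
    · rw [integral_const_mul, integral_exp_infoDensityBasis_mul b hl hz, ← Complex.exp_add,
        ← Complex.exp_add, inner_add_right]
      congr 1
      push_cast
      ring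
  · refine (integrable_exp_infoDensityBasis b hl hz ν).mono (by fun_prop)
      (.of_forall fun p => ?_)
    rw [norm_smul, Complex.norm_exp_ofReal_mul_I, mul_one]

end Basis

/-- Finite measures on a product of Hilbert spaces are determined by their characteristic
functions. -/
theorem ext_of_charFun_prod {E F : Type*} [NormedAddCommGroup E] [InnerProductSpace ℝ E]
    [NormedAddCommGroup F] [InnerProductSpace ℝ F] [MeasurableSpace E] [BorelSpace E]
    [MeasurableSpace F] [BorelSpace F] [SecondCountableTopology E] [SecondCountableTopology F]
    [CompleteSpace E] [CompleteSpace F] {μ ν : Measure (E × F)} [IsFiniteMeasure μ]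
    [IsFiniteMeasure ν]
    (h : ∀ s t, ∫ p, Complex.exp (↑(inner ℝ p.1 s + inner ℝ p.2 t) * Complex.I) ∂μ
      = ∫ p, Complex.exp (↑(inner ℝ p.1 s + inner ℝ p.2 t) * Complex.I) ∂ν) : μ = ν := by
  refine Measure.ext_of_charFunDual (funext fun L => ?_)
  -- The product type has no inner product, so a functional is restricted to each factor and
  -- represented there by Riesz.
  have hL (p : E × F) : L p
      = inner ℝ p.1 ((InnerProductSpace.toDual ℝ E).symm (L.comp (.inl ℝ E F)))
        + inner ℝ p.2 ((InnerProductSpace.toDual ℝ F).symm (L.comp (.inr ℝ E F))) := by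
    rw [real_inner_comm, InnerProductSpace.toDual_symm_apply, real_inner_comm,
      InnerProductSpace.toDual_symm_apply]
    simp [← map_add]
  simp only [charFunDual_apply, hL]
  exact h _ _

/-- Substituting `Y = X + Z` turns each summand into a quadratic in the coordinates of `X` and `Z`.
Only second moments enter, so no Gaussianity or independence is needed. -/
theorem integral_infoDensityBasis {ι E : Type*} [Fintype ι] [NormedAddCommGroup E]
    [InnerProductSpace ℝ E] {Ω : Type*} [MeasurableSpace Ω] {P : Measure Ω}
    [IsProbabilityMeasure P] (b : OrthonormalBasis ι ℝ E) {l z : ι → ℝ} (hl : ∀ k, 0 < l k)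
    (hz : ∀ k, 0 < z k) {X Y : Ω → E} (hX : MemLp X 2 P) (hZ : MemLp (fun ω => Y ω - X ω) 2 P)
    (hXX : ∀ k, ∫ ω, inner ℝ (b k) (X ω) ^ 2 ∂P = l k)
    (hXZ : ∀ k, ∫ ω, inner ℝ (b k) (X ω) * inner ℝ (b k) (Y ω - X ω) ∂P = 0) :
    Integrable (fun ω => infoDensityBasis b l z (X ω, Y ω)) P ∧
    ∫ ω, infoDensityBasis b l z (X ω, Y ω) ∂P
      = ∑ k, (1 / 2 * Real.log ((l k + z k) / z k) + l k / (2 * (z k * (l k + z k)))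
          * (z k - ∫ ω, inner ℝ (b k) (Y ω - X ω) ^ 2 ∂P)) := by
  have hXk (k) : MemLp (fun ω => inner ℝ (b k) (X ω)) 2 P := hX.const_inner (b k)
  have hZk (k) : MemLp (fun ω => inner ℝ (b k) (Y ω - X ω)) 2 P := hZ.const_inner (b k)
  have key (k) (ω) : infoDensity (l k) (z k) (inner ℝ (b k) (X ω)) (inner ℝ (b k) (Y ω))
      = 1 / 2 * Real.log ((l k + z k) / z k)
        + (1 / (2 * l k) - z k / (2 * l k * (l k + z k))) * inner ℝ (b k) (X ω) ^ 2
        + 1 / (l k + z k) * (inner ℝ (b k) (X ω) * inner ℝ (b k) (Y ω - X ω))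
        - l k / (2 * (z k * (l k + z k))) * inner ℝ (b k) (Y ω - X ω) ^ 2 := by
    have h1 := (hl k).ne'
    have h2 := (hz k).ne'
    have h3 := (add_pos (hl k) (hz k)).ne'
    unfold infoDensity
    rw [inner_sub_right]
    field_simp
    ring
  have i1 (k) : Integrable (fun ω => (1 / (2 * l k) - z k / (2 * l k * (l k + z k)))
      * inner ℝ (b k) (X ω) ^ 2) P := (hXk k).integrable_sq.const_mul _
  have i2 (k) : Integrable (fun ω => 1 / (l k + z k)
      * (inner ℝ (b k) (X ω) * inner ℝ (b k) (Y ω - X ω))) P :=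
    ((hXk k).integrable_mul (hZk k)).const_mul _
  have i3 (k) : Integrable (fun ω => l k / (2 * (z k * (l k + z k)))
      * inner ℝ (b k) (Y ω - X ω) ^ 2) P := (hZk k).integrable_sq.const_mul _
  have i4 (k) : Integrable (fun ω => 1 / 2 * Real.log ((l k + z k) / z k)
      + (1 / (2 * l k) - z k / (2 * l k * (l k + z k))) * inner ℝ (b k) (X ω) ^ 2) P :=
    (integrable_const _).add (i1 k)
  have i5 (k) : Integrable (fun ω => 1 / 2 * Real.log ((l k + z k) / z k)
      + (1 / (2 * l k) - z k / (2 * l k * (l k + z k))) * inner ℝ (b k) (X ω) ^ 2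
      + 1 / (l k + z k) * (inner ℝ (b k) (X ω) * inner ℝ (b k) (Y ω - X ω))) P :=
    (i4 k).add (i2 k)
  simp only [infoDensityBasis, key]
  refine ⟨integrable_finsetSum _ fun k _ => (i5 k).sub (i3 k), ?_⟩
  refine (integral_finsetSum _ fun k _ => (i5 k).sub (i3 k)).trans ?_
  refine Finset.sum_congr rfl fun k _ => ?_
  refine (integral_sub (i5 k) (i3 k)).trans ?_
  rw [integral_add (i4 k) (i2 k), integral_add (integrable_const _) (i1 k)]
  simp only [integral_const_mul, hXX, hXZ]
  have h1 := (hl k).ne'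
  have h2 := (hz k).ne'
  have h3 := (add_pos (hl k) (hz k)).ne'
  simp
  field_simp
  ring

/-! ### Joint laws generated by the backward channel. -/

section Basis

variable {ι E : Type*} [Fintype ι] [NormedAddCommGroup E] [InnerProductSpace ℝ E]
  [MeasurableSpace E] [BorelSpace E] [SecondCountableTopology E] [CompleteSpace E]

/-- If the backward channel turns the input law `ν` into `N(0, l)`, then `ν = N(0, l + z)`. -/
theorem eq_diagGaussian_of_map_fst_tilted (b : OrthonormalBasis ι ℝ E) {l z : ι → ℝ}
    (hl : ∀ k, 0 < l k) (hz : ∀ k, 0 < z k) (ν : Measure E) [IsProbabilityMeasure ν]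
    (h : (((diagGaussian b l).prod ν).tilted (infoDensityBasis b l z)).map Prod.fst
      = diagGaussian b l) : ν = diagGaussian b fun k => l k + z k := by
  have hlz (k) : 0 < l k + z k := add_pos (hl k) (hz k)
  refine Measure.ext_of_charFun (funext fun t => ?_)
  -- Chosen so that the channel gain `l / (l + z)` carries `s` back to `t`.
  set s : E := ∑ k, ((l k + z k) / l k * inner ℝ (b k) t) • b k with hs
  have hsk (k) : inner ℝ (b k) s = (l k + z k) / l k * inner ℝ (b k) t :=
    inner_basis_sum_smul b _ k
  have h1 := integral_tilted_infoDensityBasis b hl hz ν s 0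
  have h2 : ∑ k, (l k / (l k + z k) * inner ℝ (b k) s) • b k = t := by
    refine Eq.trans ?_ (b.sum_repr' t)
    refine Finset.sum_congr rfl fun k _ => ?_
    rw [hsk]
    have := (hl k).ne'
    have := (hlz k).ne'
    congr 1
    field_simp
  have h3 := charFun_diagGaussian b (fun k => (hl k).le) s
  rw [← h, charFun_apply, integral_map (by fun_prop) (by fun_prop)] at h3
  simp only [inner_zero_right, add_zero, h2, zero_add] at h1
  rw [h3] at h1
  refine mul_right_cancel₀ (Complex.exp_ne_zero _) (h1.symm.trans ?_)
  rw [charFun_diagGaussian b (fun k => (hlz k).le), ← Complex.exp_add]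
  simp only [← Complex.ofReal_neg, ← Complex.ofReal_add, ← neg_add, ← Finset.sum_add_distrib]
  congr 3
  refine Finset.sum_congr rfl fun k _ => ?_
  rw [hsk]
  have := (hl k).ne'
  have := (hlz k).ne'
  field_simp

/-- Forward and backward descriptions of the same Gaussian pair, matched through their
characteristic functions. -/
theorem map_add_diagGaussian_prod (b : OrthonormalBasis ι ℝ E) {l z : ι → ℝ}
    (hl : ∀ k, 0 < l k) (hz : ∀ k, 0 < z k) :
    ((diagGaussian b l).prod (diagGaussian b z)).map (fun p => (p.1, p.1 + p.2))
      = ((diagGaussian b l).prod (diagGaussian b fun k => l k + z k)).tilted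
          (infoDensityBasis b l z) := by
  have hlz (k) : 0 < l k + z k := add_pos (hl k) (hz k)
  have := isProbabilityMeasure_tilted
    (integrable_exp_infoDensityBasis b hl hz (diagGaussian b fun k => l k + z k))
  have hm : Measurable fun p : E × E => (p.1, p.1 + p.2) := by fun_prop
  have := Measure.isProbabilityMeasure_map (μ := (diagGaussian b l).prod (diagGaussian b z))
    hm.aemeasurable
  refine ext_of_charFun_prod fun s t => ?_
  rw [integral_tilted_infoDensityBasis b hl hz, integral_map hm.aemeasurable (by fun_prop),
    charFun_diagGaussian b (fun k => (hlz k).le), ← Complex.exp_add]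
  trans charFun (diagGaussian b l) (s + t) * charFun (diagGaussian b z) t
  · rw [charFun_apply, charFun_apply, ← integral_prod_mul]
    refine integral_congr_ae (.of_forall fun p => ?_)
    simp only
    rw [← Complex.exp_add, inner_add_right, inner_add_left]
    push_cast
    ring_nf
  · rw [charFun_diagGaussian b (fun k => (hl k).le), charFun_diagGaussian b (fun k => (hz k).le),
      ← Complex.exp_add]
    congr 1
    rw [← Complex.ofReal_neg, ← Complex.ofReal_neg, ← Complex.ofReal_neg, ← Complex.ofReal_neg,
      ← Complex.ofReal_add, ← Complex.ofReal_add, ← neg_add, ← neg_add, ← Finset.sum_add_distrib,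
      ← Finset.sum_add_distrib]
    congr 2
    refine Finset.sum_congr rfl fun k _ => ?_
    rw [inner_add_right, inner_add_right, inner_basis_sum_smul]
    have := (hlz k).ne'
    field_simp
    ring

/-- The output law of a tilted product is the input law of the backward channel. -/
theorem map_snd_tilted_infoDensityBasis (b : OrthonormalBasis ι ℝ E) {l z : ι → ℝ}
    (hl : ∀ k, 0 < l k) (hz : ∀ k, 0 < z k) (ν : Measure E) [IsProbabilityMeasure ν] :
    (((diagGaussian b l).prod ν).tilted (infoDensityBasis b l z)).map Prod.snd = ν := by
  refine Measure.ext_of_charFun (funext fun t => ?_)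
  rw [charFun_apply, integral_map (by fun_prop) (by fun_prop)]
  simpa using integral_tilted_infoDensityBasis b hl hz ν 0 t

end Basis

/-! ### Relative entropy and exponential tilting. -/

section Tilted

variable {α : Type*} [MeasurableSpace α] {π κ : Measure α} [IsProbabilityMeasure π]
  [IsProbabilityMeasure κ] {f : α → ℝ}

/-- The chain `KL(π ‖ κ) = KL(π ‖ κ.tilted f) + ∫ f ∂π` for a normalized tilt. -/
theorem toReal_klDiv_tilted_add_integral (hf : Integrable f π)
    (he : Integrable (fun x => Real.exp (f x)) κ) (h1 : ∫ x, Real.exp (f x) ∂κ = 1)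
    (hfin : klDiv π κ ≠ ∞) :
    klDiv π (κ.tilted f) ≠ ∞ ∧
    (klDiv π κ).toReal = (klDiv π (κ.tilted f)).toReal + ∫ x, f x ∂π := by
  have := isProbabilityMeasure_tilted he
  obtain ⟨hac, hint⟩ := klDiv_ne_top_iff.1 hfin
  have hac' : π ≪ κ.tilted f := hac.trans (absolutelyContinuous_tilted he)
  refine ⟨klDiv_ne_top hac' (integrable_llr_tilted_right hac hf hint he), ?_⟩
  rw [toReal_klDiv_of_measure_eq hac (by simp), toReal_klDiv_of_measure_eq hac' (by simp),
    integral_llr_tilted_right hac hf he hint, h1, Real.log_one]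
  ring

theorem ofReal_integral_le_klDiv (hf : Integrable f π)
    (he : Integrable (fun x => Real.exp (f x)) κ) (h1 : ∫ x, Real.exp (f x) ∂κ = 1) :
    ENNReal.ofReal (∫ x, f x ∂π) ≤ klDiv π κ := by
  by_cases hfin : klDiv π κ = ∞
  · simp [hfin]
  · refine ENNReal.ofReal_le_of_le_toReal ?_
    rw [(toReal_klDiv_tilted_add_integral hf he h1 hfin).2]
    linarith [(klDiv π (κ.tilted f)).toReal_nonneg]

/-- Equality leaves zero divergence from the tilted measure. The sign condition `h0` guards against
the truncation in `ENNReal.ofReal`. -/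
theorem eq_tilted_of_klDiv_le (hf : Integrable f π)
    (he : Integrable (fun x => Real.exp (f x)) κ) (h1 : ∫ x, Real.exp (f x) ∂κ = 1)
    (h0 : 0 ≤ ∫ x, f x ∂π) (h : klDiv π κ ≤ ENNReal.ofReal (∫ x, f x ∂π)) :
    π = κ.tilted f := by
  have := isProbabilityMeasure_tilted he
  obtain ⟨hne, heq⟩ := toReal_klDiv_tilted_add_integral hf he h1 (ne_top_of_le_ne_top (by simp) h)
  have h' := ENNReal.toReal_le_of_le_ofReal h0 h
  have h2 : (klDiv π (κ.tilted f)).toReal = 0 :=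
    le_antisymm (by linarith) ENNReal.toReal_nonneg
  exact klDiv_eq_zero_iff.1 (((ENNReal.toReal_eq_zero_iff _).1 h2).resolve_right hne)

theorem klDiv_eq_of_eq_tilted (hf : Integrable f π)
    (he : Integrable (fun x => Real.exp (f x)) κ) (h1 : ∫ x, Real.exp (f x) ∂κ = 1)
    (h : π = κ.tilted f) : klDiv π κ = ENNReal.ofReal (∫ x, f x ∂π) := by
  have hac : π ≪ κ := h ▸ tilted_absolutelyContinuous κ f
  have hllr : llr π κ =ᵐ[π] f := by
    have := hac.ae_le (log_rnDeriv_tilted_left_self he)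
    filter_upwards [this] with x hx
    rw [llr, h, hx, h1, Real.log_one, sub_zero]
  rw [klDiv_of_ac_of_integrable hac ((integrable_congr hllr).2 hf), integral_congr_ae hllr]
  simp

end Tilted

/-! ### Spectral calculus for the covariance and the parameter `α`. -/

section Spectral

variable {N : ℕ} {K : Matrix (Fin N) (Fin N) ℝ} (hK : K.IsHermitian)

/-- The matrix with the eigenvectors of `K` and the eigenvalues `v`. -/
noncomputable def spectralMatrix (v : Fin N → ℝ) : Matrix (Fin N) (Fin N) ℝ :=
  Unitary.conjStarAlgAut ℝ (Matrix (Fin N) (Fin N) ℝ) hK.eigenvectorUnitary (Matrix.diagonal v)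

theorem spectralMatrix_eigenvalues : spectralMatrix hK hK.eigenvalues = K :=
  hK.spectral_theorem.symm

theorem spectralMatrix_add (v w : Fin N → ℝ) :
    spectralMatrix hK (v + w) = spectralMatrix hK v + spectralMatrix hK w := by
  simp only [spectralMatrix, ← map_add, Matrix.diagonal_add]
  rfl

theorem spectralMatrix_smul (c : ℝ) (v : Fin N → ℝ) :
    spectralMatrix hK (c • v) = c • spectralMatrix hK v := by
  simp only [spectralMatrix, ← map_smul, Matrix.diagonal_smul]

theorem spectralMatrix_mul (v w : Fin N → ℝ) :
    spectralMatrix hK (v * w) = spectralMatrix hK v * spectralMatrix hK w := by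
  simp only [spectralMatrix, ← map_mul, Matrix.diagonal_mul_diagonal]
  rfl

theorem spectralMatrix_eq (v : Fin N → ℝ) : spectralMatrix hK v =
    (hK.eigenvectorUnitary : Matrix (Fin N) (Fin N) ℝ) * Matrix.diagonal v
      * (hK.eigenvectorUnitary : Matrix (Fin N) (Fin N) ℝ).conjTranspose :=
  Unitary.conjStarAlgAut_apply _ _

theorem posSemidef_spectralMatrix {v : Fin N → ℝ} (hv : ∀ k, 0 ≤ v k) :
    (spectralMatrix hK v).PosSemidef := by
  rw [spectralMatrix_eq]
  exact (Matrix.PosSemidef.diagonal hv).mul_mul_conjTranspose_same _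

theorem det_spectralMatrix (v : Fin N → ℝ) : (spectralMatrix hK v).det = ∏ k, v k := by
  rw [spectralMatrix_eq, Matrix.det_mul_right_comm, ← Matrix.star_eq_conjTranspose,
    Unitary.mul_star_self_of_mem hK.eigenvectorUnitary.2, one_mul, Matrix.det_diagonal]

theorem trace_spectralMatrix (v : Fin N → ℝ) : (spectralMatrix hK v).trace = ∑ k, v k := by
  rw [spectralMatrix_eq, Matrix.trace_mul_cycle, ← Matrix.star_eq_conjTranspose,
    Unitary.star_mul_self_of_mem hK.eigenvectorUnitary.2, one_mul, Matrix.trace_diagonal]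

theorem dotProduct_spectralMatrix_mulVec (v : Fin N → ℝ) (t : EuclideanSpace ℝ (Fin N)) :
    t.ofLp ⬝ᵥ (spectralMatrix hK v).mulVec t.ofLp
      = ∑ k, v k * inner ℝ (hK.eigenvectorBasis k) t ^ 2 := by
  have h (k : Fin N) : ((hK.eigenvectorUnitary : Matrix (Fin N) (Fin N) ℝ).conjTranspose.mulVec
      t.ofLp) k = inner ℝ (hK.eigenvectorBasis k) t := by
    simp [Matrix.mulVec, dotProduct, PiLp.inner_apply, mul_comm]
  rw [spectralMatrix_eq, mul_assoc, ← Matrix.mulVec_mulVec, Matrix.dotProduct_mulVec,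
    ← Matrix.mulVec_mulVec]
  have h2 : Matrix.vecMul t.ofLp (hK.eigenvectorUnitary : Matrix (Fin N) (Fin N) ℝ)
      = (hK.eigenvectorUnitary : Matrix (Fin N) (Fin N) ℝ).conjTranspose.mulVec t.ofLp := by
    rw [Matrix.conjTranspose_eq_transpose_of_trivial, Matrix.mulVec_transpose]
  rw [h2, dotProduct]
  refine Finset.sum_congr rfl fun k _ => ?_
  rw [Matrix.mulVec_diagonal, h]
  ring

theorem multivariateGaussian_spectralMatrix {v : Fin N → ℝ} (hv : ∀ k, 0 ≤ v k) :
    multivariateGaussian 0 (spectralMatrix hK v) = diagGaussian hK.eigenvectorBasis v := by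
  refine Measure.ext_of_charFun (funext fun t => ?_)
  rw [charFun_multivariateGaussian (posSemidef_spectralMatrix hK hv), charFun_diagGaussian _ hv,
    dotProduct_spectralMatrix_mulVec]
  simp [Finset.sum_div]

/-- The eigenvalues of the optimal error covariance. -/
noncomputable def errorEigenvalue (l α : ℝ) : ℝ := 1 / 2 * (√(l ^ 2 + l * α) - l)

theorem optimalErrorCov_eq_spectralMatrix {α : ℝ} (hα : 0 < α) (hl : ∀ k, 0 < hK.eigenvalues k) :
    optimalErrorCov K α = spectralMatrix hK fun k => errorEigenvalue (hK.eigenvalues k) α := by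
  open scoped MatrixOrder in
  set s : Fin N → ℝ := fun k => √(hK.eigenvalues k ^ 2 + hK.eigenvalues k * α) with hs
  have h1 : CFC.sqrt (K ^ 2 + α • K) = spectralMatrix hK s := by
    have hnn : 0 ≤ spectralMatrix hK s :=
      (posSemidef_spectralMatrix hK fun k => Real.sqrt_nonneg _).nonneg
    refine CFC.sqrt_unique ?_ hnn
    conv_rhs => rw [← spectralMatrix_eigenvalues hK]
    rw [sq, ← spectralMatrix_mul, ← spectralMatrix_mul, ← spectralMatrix_smul,
      ← spectralMatrix_add]
    congr 1
    ext k
    have := hl k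
    simp only [hs, Pi.mul_apply, Pi.add_apply, Pi.smul_apply, smul_eq_mul]
    rw [Real.mul_self_sqrt (by positivity)]
    ring
  unfold optimalErrorCov
  rw [h1]
  conv_lhs =>
    enter [2, 2]
    rw [← spectralMatrix_eigenvalues hK]
  rw [sub_eq_add_neg, ← neg_smul, ← spectralMatrix_smul, ← spectralMatrix_smul,
    ← spectralMatrix_add]
  congr 1
  ext k
  simp only [errorEigenvalue, Pi.add_apply, Pi.smul_apply, smul_eq_mul, hs]
  ring

theorem errorEigenvalue_pos {l α : ℝ} (hl : 0 < l) (hα : 0 < α) : 0 < errorEigenvalue l α := by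
  have : l < √(l ^ 2 + l * α) := Real.lt_sqrt_of_sq_lt (by nlinarith [mul_pos hl hα])
  unfold errorEigenvalue
  linarith

/-- The stationarity condition: it equalizes the weights of all error variances in the mean of the
information density. -/
theorem errorEigenvalue_mul_add {l α : ℝ} (hl : 0 < l) (hα : 0 < α) :
    errorEigenvalue l α * (l + errorEigenvalue l α) = α * l / 4 := by
  have := Real.mul_self_sqrt (show 0 ≤ l ^ 2 + l * α by positivity)
  unfold errorEigenvalue
  linarith

theorem half_log_eq {l α : ℝ} (hl : 0 < l) (hα : 0 < α) :
    1 / 2 * Real.log ((l + errorEigenvalue l α) / errorEigenvalue l α)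
      = Real.log ((√(l + α) + √l) / √α) := by
  have h1 : √(l ^ 2 + l * α) = √l * √(l + α) := by
    rw [← Real.sqrt_mul hl.le]
    ring_nf
  have hl' := Real.mul_self_sqrt hl.le
  have ha' := Real.mul_self_sqrt hα.le
  have hla' := Real.mul_self_sqrt (show 0 ≤ l + α by positivity)
  have p1 := Real.sqrt_pos.2 hl
  have p2 := Real.sqrt_pos.2 hα
  have hz := errorEigenvalue_pos hl hα
  -- With `p = √l` and `q = √(l + α)`, the ratio is `(q + p) / (q - p)`, and `α = (q + p) (q - p)`.
  have h2 : (l + errorEigenvalue l α) / errorEigenvalue l α = ((√(l + α) + √l) / √α) ^ 2 := by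
    rw [div_pow, Real.sq_sqrt hα.le, div_eq_div_iff hz.ne' hα.ne']
    unfold errorEigenvalue
    rw [h1]
    set p := √l
    set q := √(l + α)
    have e2 : α = q * q - p * p := by linarith
    rw [e2, ← hl']
    ring
  rw [h2, Real.log_pow]
  push_cast
  ring

theorem existsUnique_waterLevel (hN : 0 < N) {l : Fin N → ℝ} (hl : ∀ k, 0 < l k) {D : ℝ}
    (hD : 0 < D) :
    ∃! α : ℝ, 0 < α ∧ D = 1 / (2 * (N : ℝ)) * ∑ k, (√(l k ^ 2 + l k * α) - l k) := by
  have hN' : (0 : ℝ) < N := by exact_mod_cast hN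
  have : Nonempty (Fin N) := ⟨⟨0, hN⟩⟩
  set F : ℝ → ℝ := fun α => 1 / (2 * (N : ℝ)) * ∑ k, (√(l k ^ 2 + l k * α) - l k) with hF
  have hmono : StrictMonoOn F (Set.Ici 0) := by
    intro a ha c _ hac
    refine mul_lt_mul_of_pos_left (Finset.sum_lt_sum_of_nonempty Finset.univ_nonempty
      fun k _ => ?_) (by positivity)
    have := hl k
    have ha' : 0 ≤ a := ha
    have : √(l k ^ 2 + l k * a) < √(l k ^ 2 + l k * c) :=
      Real.sqrt_lt_sqrt (by positivity) (by nlinarith)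
    linarith
  have hcont : Continuous F := by fun_prop
  have h0 : F 0 = 0 := by
    simp [hF, Real.sqrt_sq (hl _).le]
  obtain ⟨k₀⟩ := this
  have hlarge : ∃ M, 0 ≤ M ∧ D ≤ F M := by
    have hk := hl k₀
    -- At this value the summand of `k₀` alone is at least `2 N D`, and the others are nonnegative.
    refine ⟨(2 * N * D + l k₀) ^ 2 / l k₀, by positivity, ?_⟩
    have h1 (k : Fin N) : 0 ≤ √(l k ^ 2 + l k * ((2 * N * D + l k₀) ^ 2 / l k₀)) - l k := by
      have := hl k
      rw [sub_nonneg]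
      refine Real.le_sqrt_of_sq_le ?_
      have : 0 ≤ l k * ((2 * N * D + l k₀) ^ 2 / l k₀) := by positivity
      linarith
    have h2 := Finset.single_le_sum (fun k _ => h1 k) (Finset.mem_univ k₀)
    have h3 : 2 * N * D + l k₀ ≤ √(l k₀ ^ 2 + l k₀ * ((2 * N * D + l k₀) ^ 2 / l k₀)) := by
      refine Real.le_sqrt_of_sq_le ?_
      rw [mul_div_cancel₀ _ hk.ne']
      nlinarith
    have h4 : D = 1 / (2 * (N : ℝ)) * (2 * N * D) := by field_simp
    calc D = 1 / (2 * (N : ℝ)) * (2 * N * D) := h4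
      _ ≤ _ := mul_le_mul_of_nonneg_left (by linarith) (by positivity)
  obtain ⟨M, hM, hDM⟩ := hlarge
  obtain ⟨α, hα, hFα⟩ := intermediate_value_Icc hM hcont.continuousOn
    (show D ∈ Set.Icc (F 0) (F M) from ⟨h0.trans_le hD.le, hDM⟩)
  have hpos : 0 < α := lt_of_le_of_ne hα.1 fun h => by
    rw [← h, h0] at hFα
    exact hD.ne hFα
  refine ⟨α, ⟨hpos, hFα.symm⟩, fun c hc => ?_⟩
  exact hmono.injOn (show (0 : ℝ) ≤ c from hc.1.le) (show (0 : ℝ) ≤ α from hpos.le)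
    (hc.2.symm.trans hFα.symm)

end Spectral

/-! ### Second moments of random vectors. -/

section Moments

variable {Ω : Type*} [MeasurableSpace Ω] {N : ℕ} {P : Measure Ω}

theorem memLp_eval {U : Ω → EuclideanSpace ℝ (Fin N)} (hU : MemLp U 2 P) (i : Fin N) :
    MemLp (fun ω => U ω i) 2 P := by
  simpa [EuclideanSpace.inner_single_left] using
    hU.const_inner (𝕜 := ℝ) (EuclideanSpace.single i (1 : ℝ))

theorem integral_inner_mul_inner {U V : Ω → EuclideanSpace ℝ (Fin N)} (hU : MemLp U 2 P)
    (hV : MemLp V 2 P) (u v : EuclideanSpace ℝ (Fin N)) :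
    ∫ ω, inner ℝ u (U ω) * inner ℝ v (V ω) ∂P
      = u.ofLp ⬝ᵥ (crossMoment P U V).mulVec v.ofLp := by
  have h (ω) : inner ℝ u (U ω) * inner ℝ v (V ω)
      = ∑ i, ∑ j, u i * (U ω i * V ω j) * v j := by
    simp only [PiLp.inner_apply, RCLike.inner_apply, conj_trivial, Finset.sum_mul_sum]
    exact Finset.sum_congr rfl fun i _ => Finset.sum_congr rfl fun j _ => by ring
  have hint (i j : Fin N) : Integrable (fun ω => u i * (U ω i * V ω j) * v j) P :=
    (((memLp_eval hU i).integrable_mul (memLp_eval hV j)).const_mul _).mul_const _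
  simp_rw [h]
  rw [integral_finsetSum _ fun i _ => integrable_finsetSum _ fun j _ => hint i j]
  refine Finset.sum_congr rfl fun i _ => ?_
  rw [integral_finsetSum _ fun j _ => hint i j, Matrix.mulVec, dotProduct, Finset.mul_sum]
  refine Finset.sum_congr rfl fun j _ => ?_
  rw [integral_mul_const, integral_const_mul, crossMoment, Matrix.of_apply, mul_assoc]

/-- Parseval: the trace is the mean squared norm, computable in any orthonormal basis. -/
theorem trace_crossMoment_self {U : Ω → EuclideanSpace ℝ (Fin N)} (hU : MemLp U 2 P)
    (b : OrthonormalBasis (Fin N) ℝ (EuclideanSpace ℝ (Fin N))) :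
    (crossMoment P U U).trace = ∑ k, ∫ ω, inner ℝ (b k) (U ω) ^ 2 ∂P := by
  rw [← integral_finsetSum _ fun k _ => (hU.const_inner (b k)).integrable_sq, Matrix.trace]
  simp only [Matrix.diag, crossMoment, Matrix.of_apply]
  refine (integral_finsetSum _ fun k _ =>
    (memLp_eval hU k).integrable_mul (memLp_eval hU k)).symm.trans ?_
  refine integral_congr_ae (.of_forall fun ω => ?_)
  simp only
  have h1 := b.sum_sq_norm_inner_right (U ω)
  have h2 := EuclideanSpace.real_norm_sq_eq (U ω)
  simp only [Real.norm_eq_abs, sq_abs] at h1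
  rw [h1, h2]
  exact Finset.sum_congr rfl fun i _ => (pow_two _).symm

theorem memLp_two_of_hasLaw {U : Ω → EuclideanSpace ℝ (Fin N)} {S : Matrix (Fin N) (Fin N) ℝ}
    (hU : HasLaw U (multivariateGaussian 0 S) P) : MemLp U 2 P :=
  hU.hasGaussianLaw.memLp_two

theorem integral_inner_of_hasLaw {U : Ω → EuclideanSpace ℝ (Fin N)}
    {S : Matrix (Fin N) (Fin N) ℝ} (hU : HasLaw U (multivariateGaussian 0 S) P)
    (u : EuclideanSpace ℝ (Fin N)) : ∫ ω, inner ℝ u (U ω) ∂P = 0 := by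
  rw [integral_inner hU.hasGaussianLaw.integrable, hU.integral_eq]
  simp

theorem integral_eval_of_hasLaw {U : Ω → EuclideanSpace ℝ (Fin N)}
    {S : Matrix (Fin N) (Fin N) ℝ} (hU : HasLaw U (multivariateGaussian 0 S) P)
    (i : Fin N) : ∫ ω, U ω i ∂P = 0 := by
  simpa [EuclideanSpace.inner_single_left] using
    integral_inner_of_hasLaw hU (EuclideanSpace.single i 1)

theorem crossMoment_self_of_hasLaw [IsProbabilityMeasure P] {U : Ω → EuclideanSpace ℝ (Fin N)}
    {S : Matrix (Fin N) (Fin N) ℝ} (hS : S.PosSemidef)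
    (hU : HasLaw U (multivariateGaussian 0 S) P) : crossMoment P U U = S := by
  ext i j
  have hm := memLp_two_of_hasLaw hU
  have h := hU.covariance_comp (f := fun x => x i) (g := fun x => x j) (by fun_prop) (by fun_prop)
  have h2 : cov[fun ω => U ω i, fun ω => U ω j; P] = S i j :=
    h.trans (covariance_eval_multivariateGaussian hS i j)
  rw [covariance_eq_sub (memLp_eval hm i) (memLp_eval hm j), integral_eval_of_hasLaw hU,
    zero_mul, sub_zero] at h2
  exact h2

end Moments

/-! ### The lower bound, its equality case and its attainment. -/

section Main

theorem Admissible.trace_le {Ω : Type*} [MeasurableSpace Ω] {N : ℕ}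
    {P : Measure Ω} {X Y : Ω → EuclideanSpace ℝ (Fin N)} {D : ℝ} (h : Admissible P X Y D) (hN : 0 < N) :
    (crossMoment P (fun ω => Y ω - X ω) (fun ω => Y ω - X ω)).trace ≤ N * D := by
  have hN' : (0 : ℝ) < N := by exact_mod_cast hN
  have := h.distortion_le
  rwa [one_div_mul_eq_div, div_le_iff₀ hN', mul_comm] at this

variable {Ω : Type*} [MeasurableSpace Ω] {N : ℕ} {P : Measure Ω} [IsProbabilityMeasure P]
  {X Y : Ω → EuclideanSpace ℝ (Fin N)} {K : Matrix (Fin N) (Fin N) ℝ} {α D : ℝ}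

/-- The minimal mutual information, in the eigenvalues `l` of the source covariance. -/
noncomputable def minimalInfo {N : ℕ} (l : Fin N → ℝ) (α : ℝ) : ℝ :=
  ∑ k, Real.log ((√(l k + α) + √(l k)) / √α)

theorem minimalInfo_nonneg {l : Fin N → ℝ} (hl : ∀ k, 0 < l k) (hα : 0 < α) :
    0 ≤ minimalInfo l α := by
  refine Finset.sum_nonneg fun k _ => Real.log_nonneg ?_
  rw [one_le_div (Real.sqrt_pos.2 hα)]
  have := Real.sqrt_le_sqrt (show α ≤ l k + α by linarith [hl k])
  linarith [Real.sqrt_nonneg (l k)]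

theorem integral_infoDensityBasis_of_uncorrelated (hK : K.PosDef) (hα : 0 < α)
    (hX : HasLaw X (multivariateGaussian 0 K) P) (hZ : MemLp (fun ω => Y ω - X ω) 2 P)
    (hXZ : crossMoment P X (fun ω => Y ω - X ω) = 0) :
    Integrable (fun ω => infoDensityBasis hK.isHermitian.eigenvectorBasis hK.isHermitian.eigenvalues
      (fun k => errorEigenvalue (hK.isHermitian.eigenvalues k) α) (X ω, Y ω)) P ∧
    ∫ ω, infoDensityBasis hK.isHermitian.eigenvectorBasis hK.isHermitian.eigenvalues
      (fun k => errorEigenvalue (hK.isHermitian.eigenvalues k) α) (X ω, Y ω) ∂P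
      = minimalInfo hK.isHermitian.eigenvalues α + 2 / α *
        (∑ k, errorEigenvalue (hK.isHermitian.eigenvalues k) α
          - (crossMoment P (fun ω => Y ω - X ω) (fun ω => Y ω - X ω)).trace) := by
  have hl := hK.eigenvalues_pos
  have hz (k) := errorEigenvalue_pos (hl k) hα
  have hX2 := memLp_two_of_hasLaw hX
  set b := hK.isHermitian.eigenvectorBasis
  have hXX (k) : ∫ ω, inner ℝ (b k) (X ω) ^ 2 ∂P = hK.isHermitian.eigenvalues k := by
    simp only [pow_two]
    rw [integral_inner_mul_inner hX2 hX2, crossMoment_self_of_hasLaw hK.posSemidef hX,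
      hK.isHermitian.mulVec_eigenvectorBasis, dotProduct_smul]
    have h : (b k).ofLp ⬝ᵥ (b k).ofLp = 1 := by
      have := b.orthonormal.1 k
      rw [← one_pow 2, ← this, EuclideanSpace.real_norm_sq_eq, dotProduct]
      exact Finset.sum_congr rfl fun i _ => (pow_two _).symm
    rw [h, smul_eq_mul, mul_one]
  have hXZ' (k) : ∫ ω, inner ℝ (b k) (X ω) * inner ℝ (b k) (Y ω - X ω) ∂P = 0 := by
    rw [integral_inner_mul_inner hX2 hZ, hXZ]
    simp
  obtain ⟨h1, h2⟩ := integral_infoDensityBasis b hl hz hX2 hZ hXX hXZ'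
  refine ⟨h1, h2.trans ?_⟩
  rw [Finset.sum_add_distrib, trace_crossMoment_self hZ b, ← Finset.sum_sub_distrib,
    Finset.mul_sum, minimalInfo]
  congr 1
  · exact Finset.sum_congr rfl fun k _ => half_log_eq (hl k) hα
  · refine Finset.sum_congr rfl fun k _ => ?_
    rw [add_comm, add_comm, errorEigenvalue_mul_add (hl k) hα]
    congr 1
    have := (hl k).ne'
    field_simp
    norm_num

theorem isProbabilityMeasure_map_pair (hX : AEMeasurable X P) (hY : AEMeasurable Y P) :
    IsProbabilityMeasure (P.map fun ω => (X ω, Y ω)) ∧ IsProbabilityMeasure (P.map Y) :=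
  ⟨Measure.isProbabilityMeasure_map (hX.prodMk hY), Measure.isProbabilityMeasure_map hY⟩

theorem mutualInfo_bound (hN : 0 < N) (hK : K.PosDef) (hα : 0 < α)
    (hX : HasLaw X (multivariateGaussian 0 K) P)
    (hD : N * D = ∑ k, errorEigenvalue (hK.isHermitian.eigenvalues k) α)
    (h : Admissible P X Y D) :
    ENNReal.ofReal (minimalInfo hK.isHermitian.eigenvalues α) ≤ mutualInfo P X Y ∧
    (mutualInfo P X Y = ENNReal.ofReal (minimalInfo hK.isHermitian.eigenvalues α) ↔
      P.map (fun ω => (X ω, Y ω - X ω)) = (multivariateGaussian 0 K).prod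
        (multivariateGaussian 0 (optimalErrorCov K α))) := by
  have hl := hK.eigenvalues_pos
  have hz (k) := errorEigenvalue_pos (hl k) hα
  obtain ⟨hint, heq⟩ := integral_infoDensityBasis_of_uncorrelated hK hα hX h.memLp_error
    h.uncorrelated
  have htr := h.trace_le hN
  have hnn := minimalInfo_nonneg hl hα
  have hYm := h.aemeasurable
  have hXm := hX.aemeasurable
  have hXY : AEMeasurable (fun ω => (X ω, Y ω)) P := hXm.prodMk hYm
  have hXZ : AEMeasurable (fun ω => (X ω, Y ω - X ω)) P := hXm.prodMk (hYm.sub hXm)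
  obtain ⟨_, _⟩ := isProbabilityMeasure_map_pair hXm hYm
  have hT := optimalErrorCov_eq_spectralMatrix hK.isHermitian hα hl
  have hTlaw : multivariateGaussian 0 (optimalErrorCov K α)
      = diagGaussian hK.isHermitian.eigenvectorBasis
        fun k => errorEigenvalue (hK.isHermitian.eigenvalues k) α := by
    rw [hT, multivariateGaussian_spectralMatrix _ fun k => (hz k).le]
  have hKlaw : multivariateGaussian 0 K
      = diagGaussian hK.isHermitian.eigenvectorBasis hK.isHermitian.eigenvalues := by
    rw [← multivariateGaussian_spectralMatrix _ fun k => (hl k).le, spectralMatrix_eigenvalues]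
  set b := hK.isHermitian.eigenvectorBasis
  set l := hK.isHermitian.eigenvalues
  set z : Fin N → ℝ := fun k => errorEigenvalue (l k) α
  set g := infoDensityBasis b l z
  have hg : Continuous g := continuous_infoDensityBasis b l z
  have hint' : Integrable g (P.map fun ω => (X ω, Y ω)) :=
    (integrable_map_measure hg.aestronglyMeasurable hXY).2 hint
  have heq' : ∫ p, g p ∂P.map (fun ω => (X ω, Y ω)) = _ :=
    (integral_map hXY hg.aestronglyMeasurable).trans heq
  have hPX : P.map X = diagGaussian b l := hX.map_eq.trans hKlaw
  have he := integrable_exp_infoDensityBasis b hl hz (P.map Y)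
  have h1 := integral_exp_infoDensityBasis b hl hz (P.map Y)
  -- The distortion constraint enters here: the error trace is at most `N * D`, which is the sum of
  -- the `z k`.
  have hge : minimalInfo l α ≤ ∫ p, g p ∂P.map (fun ω => (X ω, Y ω)) := by
    rw [heq']
    have : 0 ≤ 2 / α * (∑ k, z k - (crossMoment P (fun ω => Y ω - X ω)
        (fun ω => Y ω - X ω)).trace) :=
      mul_nonneg (by positivity) (by rw [← hD]; linarith)
    linarith
  have hMI : mutualInfo P X Y
      = klDiv (P.map fun ω => (X ω, Y ω)) ((diagGaussian b l).prod (P.map Y)) := by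
    rw [mutualInfo, hPX]
  rw [hMI, hTlaw, hKlaw]
  have hshear : Measurable fun p : EuclideanSpace ℝ (Fin N) × EuclideanSpace ℝ (Fin N) =>
      (p.1, p.1 + p.2) := by fun_prop
  have hunshear : Measurable fun p : EuclideanSpace ℝ (Fin N) × EuclideanSpace ℝ (Fin N) =>
      (p.1, p.2 - p.1) := by fun_prop
  refine ⟨(ENNReal.ofReal_le_ofReal hge).trans (ofReal_integral_le_klDiv hint' he h1),
    fun hmin => ?_, fun hlaw => ?_⟩
  · have htilt := eq_tilted_of_klDiv_le hint' he h1 (hnn.trans hge)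
      (hmin.trans_le (ENNReal.ofReal_le_ofReal hge))
    -- The first marginal of the tilted law must be the source law, which pins down the law of `Y`.
    have hY : P.map Y = diagGaussian b fun k => l k + z k := by
      refine eq_diagGaussian_of_map_fst_tilted b hl hz _ ?_
      rw [← htilt, AEMeasurable.map_map_of_aemeasurable (by fun_prop) hXY]
      exact hPX
    rw [hY, ← map_add_diagGaussian_prod b hl hz] at htilt
    have := congrArg (fun m => m.map fun p => (p.1, p.2 - p.1)) htilt
    rw [AEMeasurable.map_map_of_aemeasurable hunshear.aemeasurable hXY,
      Measure.map_map hunshear hshear] at this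
    refine this.trans ?_
    convert! Measure.map_id
    ext p <;> simp
  · have htilt : P.map (fun ω => (X ω, Y ω))
        = ((diagGaussian b l).prod (diagGaussian b fun k => l k + z k)).tilted g := by
      rw [← map_add_diagGaussian_prod b hl hz, ← hlaw,
        AEMeasurable.map_map_of_aemeasurable hshear.aemeasurable hXZ]
      congr 1
      ext ω <;> simp
    have hY : P.map Y = diagGaussian b fun k => l k + z k := by
      rw [← map_snd_tilted_infoDensityBasis b hl hz (diagGaussian b fun k => l k + z k), ← htilt,
        AEMeasurable.map_map_of_aemeasurable (by fun_prop) hXY]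
      rfl
    rw [← hY] at htilt
    rw [klDiv_eq_of_eq_tilted hint' he h1 htilt, heq']
    have hZlaw : HasLaw (fun ω => Y ω - X ω) (multivariateGaussian 0 (optimalErrorCov K α)) P := by
      refine ⟨hYm.sub hXm, ?_⟩
      have := congrArg (fun m => m.map Prod.snd) hlaw
      rw [AEMeasurable.map_map_of_aemeasurable (by fun_prop) hXZ] at this
      rw [hTlaw]
      simpa [Function.comp_def] using this
    have hTpsd : (optimalErrorCov K α).PosSemidef := by
      rw [hT]
      exact posSemidef_spectralMatrix _ fun k => (hz k).le
    rw [crossMoment_self_of_hasLaw hTpsd hZlaw, hT, trace_spectralMatrix, sub_self, mul_zero,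
      add_zero]

/-- For jointly Gaussian vectors, uncorrelated means independent. -/
theorem map_pair_eq_prod_iff (hX : HasLaw X (multivariateGaussian 0 K) P)
    {T : Matrix (Fin N) (Fin N) ℝ} {Z : Ω → EuclideanSpace ℝ (Fin N)} (hZm : MemLp Z 2 P)
    (hXZ : crossMoment P X Z = 0) :
    P.map (fun ω => (X ω, Z ω))
        = (multivariateGaussian 0 K).prod (multivariateGaussian 0 T) ↔
      HasGaussianLaw (fun ω => (X ω, Z ω)) P ∧ HasLaw Z (multivariateGaussian 0 T) P := by
  have hXm := hX.aemeasurable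
  have hZa := hZm.aestronglyMeasurable.aemeasurable
  constructor
  · intro h
    have hZ : P.map Z = multivariateGaussian 0 T := by
      have := congrArg (fun m => m.map Prod.snd) h
      rw [AEMeasurable.map_map_of_aemeasurable (by fun_prop) (hXm.prodMk hZa)] at this
      simpa [Function.comp_def] using this
    refine ⟨⟨?_⟩, ⟨hZa, hZ⟩⟩
    rw [h]
    infer_instance
  · rintro ⟨hG, hZ⟩
    have hind : IndepFun X Z P := by
      refine hG.indepFun_of_covariance_inner fun x y => ?_
      have hX2 := memLp_two_of_hasLaw hX
      -- Because `X` is centered, its covariance with `Z` is the cross moment.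
      rw [covariance_eq_sub (hX2.const_inner x) (hZm.const_inner y),
        integral_inner_of_hasLaw hX, zero_mul, sub_zero]
      refine (integral_inner_mul_inner hX2 hZm x y).trans ?_
      rw [hXZ]
      simp
    rw [(indepFun_iff_map_prod_eq_prod_map_map hXm hZa).1 hind, hX.map_eq, hZ.map_eq]

/-- The optimal joint law: `Y = X + Z` with `Z` Gaussian and independent of `X`. -/
noncomputable def optimalLaw (K : Matrix (Fin N) (Fin N) ℝ) (α : ℝ) :
    Measure (EuclideanSpace ℝ (Fin N) × EuclideanSpace ℝ (Fin N)) :=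
  ((multivariateGaussian 0 K).prod (multivariateGaussian 0 (optimalErrorCov K α))).map
    fun p => (p.1, p.1 + p.2)

instance isProbabilityMeasure_optimalLaw : IsProbabilityMeasure (optimalLaw K α) :=
  Measure.isProbabilityMeasure_map (by fun_prop)

theorem map_fst_optimalLaw : (optimalLaw K α).map Prod.fst = multivariateGaussian 0 K := by
  rw [optimalLaw, Measure.map_map (by fun_prop) (by fun_prop)]
  simp [Function.comp_def]

theorem map_sub_optimalLaw : (optimalLaw K α).map (fun p => (p.1, p.2 - p.1))
    = (multivariateGaussian 0 K).prod (multivariateGaussian 0 (optimalErrorCov K α)) := by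
  rw [optimalLaw, Measure.map_map (by fun_prop) (by fun_prop)]
  convert! Measure.map_id
  ext p <;> simp

theorem hasLaw_sub_optimalLaw : HasLaw (fun p => p.2 - p.1)
    (multivariateGaussian 0 (optimalErrorCov K α)) (optimalLaw K α) := by
  refine ⟨by fun_prop, ?_⟩
  rw [optimalLaw, Measure.map_map (by fun_prop) (by fun_prop)]
  simp [Function.comp_def]

theorem admissible_optimalLaw (hN : 0 < N) (hK : K.PosDef) (hα : 0 < α)
    (hD : N * D = ∑ k, errorEigenvalue (hK.isHermitian.eigenvalues k) α) :
    Admissible (optimalLaw K α) Prod.fst Prod.snd D := by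
  have hN' : (0 : ℝ) < N := by exact_mod_cast hN
  have hl := hK.eigenvalues_pos
  have hz (k) := errorEigenvalue_pos (hl k) hα
  have hT := optimalErrorCov_eq_spectralMatrix hK.isHermitian hα hl
  have hTpsd : (optimalErrorCov K α).PosSemidef := by
    rw [hT]
    exact posSemidef_spectralMatrix _ fun k => (hz k).le
  have hZ := hasLaw_sub_optimalLaw (K := K) (α := α)
  have hX : HasLaw Prod.fst (multivariateGaussian 0 K) (optimalLaw K α) :=
    ⟨by fun_prop, map_fst_optimalLaw⟩
  have hX2 := memLp_two_of_hasLaw hX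
  have hZ2 := memLp_two_of_hasLaw hZ
  have hZZ := crossMoment_self_of_hasLaw hTpsd hZ
  refine ⟨by fun_prop, hZ2, fun i j => (memLp_eval hX2 i).integrable_mul (memLp_eval hZ2 j), ?_,
    ?_, ?_⟩
  · ext i j
    -- In the coordinates `(X, Z)` the law is a product, so the cross moment factors through the
    -- zero mean of `X`.
    have h := integral_map (μ := optimalLaw K α) (φ := fun p => (p.1, p.2 - p.1))
      (f := fun p => p.1 i * p.2 j) (by fun_prop) (by fun_prop)
    rw [map_sub_optimalLaw, integral_prod_mul
      (fun x : EuclideanSpace ℝ (Fin N) => x i) (fun x : EuclideanSpace ℝ (Fin N) => x j),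
      show ∫ x : EuclideanSpace ℝ (Fin N), x i ∂multivariateGaussian 0 K = 0 from
        integral_eval_of_hasLaw HasLaw.id i, zero_mul] at h
    exact h.symm
  · rw [hZZ, hT, trace_spectralMatrix, ← hD]
    exact le_of_eq (by field_simp)
  · rw [hZZ, hT, det_spectralMatrix]
    exact Finset.prod_pos fun k _ => hz k

end Main

end UncorrelatedRD

/-! ### The rate-distortion theorem. -/

theorem mainTheorem1 {Ω : Type*} [MeasurableSpace Ω] (P : Measure Ω) [IsProbabilityMeasure P]
    (N : ℕ) (hN : 0 < N) (X : Ω → EuclideanSpace ℝ (Fin N))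
    (K : Matrix (Fin N) (Fin N) ℝ) (hK : K.PosDef)
    (hX : HasLaw X (multivariateGaussian 0 K) P) (D : ℝ) (hD : 0 < D) :
    (∃! α : ℝ, 0 < α ∧
      D = 1 / (2 * (N : ℝ)) * ∑ k, (√(hK.isHermitian.eigenvalues k ^ 2
        + hK.isHermitian.eigenvalues k * α) - hK.isHermitian.eigenvalues k)) ∧
    ∀ α : ℝ, 0 < α →
      D = 1 / (2 * (N : ℝ)) * ∑ k, (√(hK.isHermitian.eigenvalues k ^ 2
        + hK.isHermitian.eigenvalues k * α) - hK.isHermitian.eigenvalues k) →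
      IsLeast (UncorrelatedRD.admissibleRates (P.map X) D)
        (UncorrelatedRD.rdPerp (P.map X) D) ∧
      UncorrelatedRD.rdPerp (P.map X) D = ENNReal.ofReal (1 / (N : ℝ) *
        ∑ k, Real.log ((√(hK.isHermitian.eigenvalues k + α)
          + √(hK.isHermitian.eigenvalues k)) / √α)) ∧
      ∀ Y : Ω → EuclideanSpace ℝ (Fin N), UncorrelatedRD.Admissible P X Y D →
        (UncorrelatedRD.mutualInfoPerDim P X Y = UncorrelatedRD.rdPerp (P.map X) D ↔
          HasGaussianLaw (fun ω => (X ω, Y ω - X ω)) P ∧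
          HasLaw (fun ω => Y ω - X ω)
            (multivariateGaussian 0 (UncorrelatedRD.optimalErrorCov K α)) P) := by
  have hl := hK.eigenvalues_pos
  have hN' : (0 : ℝ) < N := by exact_mod_cast hN
  have hN0 : (N : ℝ≥0∞) ≠ 0 := by exact_mod_cast hN.ne'
  refine ⟨UncorrelatedRD.existsUnique_waterLevel hN hl hD, fun α hα hDα => ?_⟩
  -- The equation for `α` says that the optimal error covariance spends the whole distortion budget.
  have hD' : N * D
      = ∑ k, UncorrelatedRD.errorEigenvalue (hK.isHermitian.eigenvalues k) α := by
    simp only [UncorrelatedRD.errorEigenvalue]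
    rw [← Finset.mul_sum, hDα]
    field_simp
  have hrate : ENNReal.ofReal (1 / (N : ℝ) *
        ∑ k, Real.log ((√(hK.isHermitian.eigenvalues k + α)
          + √(hK.isHermitian.eigenvalues k)) / √α))
      = ENNReal.ofReal (UncorrelatedRD.minimalInfo hK.isHermitian.eigenvalues α) / N := by
    rw [one_div_mul_eq_div, ENNReal.ofReal_div_of_pos hN', ENNReal.ofReal_natCast]
    rfl
  have hleast : IsLeast (UncorrelatedRD.admissibleRates (P.map X) D)
      (ENNReal.ofReal (UncorrelatedRD.minimalInfo hK.isHermitian.eigenvalues α) / N) := by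
    rw [hX.map_eq]
    constructor
    · have hadm := UncorrelatedRD.admissible_optimalLaw hN hK hα hD'
      refine ⟨UncorrelatedRD.optimalLaw K α, inferInstance, UncorrelatedRD.map_fst_optimalLaw,
        hadm, ?_⟩
      rw [UncorrelatedRD.mutualInfoPerDim, (UncorrelatedRD.mutualInfo_bound hN hK hα
        ⟨by fun_prop, UncorrelatedRD.map_fst_optimalLaw⟩ hD' hadm).2.2
        UncorrelatedRD.map_sub_optimalLaw]
    · rintro r ⟨π, hπ, hfst, hadm, rfl⟩
      exact ENNReal.div_le_div_right (UncorrelatedRD.mutualInfo_bound hN hK hα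
        ⟨by fun_prop, hfst⟩ hD' hadm).1 _
  have hrd : UncorrelatedRD.rdPerp (P.map X) D
      = ENNReal.ofReal (UncorrelatedRD.minimalInfo hK.isHermitian.eigenvalues α) / N :=
    hleast.isGLB.sInf_eq
  rw [hrd, hrate]
  refine ⟨hleast, rfl, fun Y hY => ?_⟩
  rw [← UncorrelatedRD.map_pair_eq_prod_iff hX hY.memLp_error hY.uncorrelated,
    ← (UncorrelatedRD.mutualInfo_bound hN hK hα hX hD' hY).2, UncorrelatedRD.mutualInfoPerDim]
  refine ⟨fun h => ?_, fun h => by rw [h]⟩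
  -- Division by `N` is undone in `ℝ≥0∞`, as `N` is neither zero nor infinite.
  have := congrArg (· * (N : ℝ≥0∞)) h
  simpa only [ENNReal.div_mul_cancel hN0 (ENNReal.natCast_ne_top N)] using this
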